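/- All semigroups are nonempty. An inverse semigroup is a semigroup in which every $a$ has a unique $b$ with $aba=a$ and $bab=b$; an inverse subsemigroup (a subgroup) of a semigroup is a subsemigroup that is itself an inverse semigroup (a group). For a semigroup $S$ let $\sigma_i(S)$ (respectively $\sigma_g(S)$) be the least number of proper inverse subsemigroups (respectively proper subgroups) of $S$ whose union is $S$, and $\infty$ if there is no finite covering of this kind. Let $S^1$ be $S$ with an identity adjoined if it has none; $x,y\in S$ are $\mathcal J$-related if $S^1xS^1=S^1yS^1$, and the classes of this equivalence relation are the $\mathcal J$-classes. The principal factor of a $\mathcal J$-class $J$ is $J^*=J\cup\{0\}$ (with $0$ a new element) with the product $s*t=st$ if $s,t,st\in J$ and $s*t=0$ otherwise. For a set $K$, a group $G$ and a $K\times K$ matrix $P=(p_{\lambda,\mu})$ over $G\cup\{0\}$, the Rees $0$-matrix semigroup $\mathcal M^0[K,G,K;P]$ is $(K\times G\times K)\cup\{0\}$ with $(\kappa,g,\lambda)(\mu,h,\nu)=(\kappa,gp_{\lambda,\mu}h,\nu)$ if $p_{\lambda,\mu}\ne0$, and all other products equal to $0$. **Theorem.** Let $I$ be a finite inverse semigroup.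 (i) If $I$ is a group, then $\sigma_i(I)=\sigma_g(I)$. (ii) If $I$ is not generated by a single $\mathcal J$-class, then $\sigma_i(I)=2$. (iii) If $I$ is not a group but is generated by a single $\mathcal J$-class $J$, then $J^*$ is isomorphic to a Rees $0$-matrix semigroup $\mathcal M^0[K,G,K;P]$ with $|K|\ge2$. Moreover, for every $K$, $G$, $P$ with $J^*\cong\mathcal M^0[K,G,K;P]$ one has $|K|\ge2$ and: (a) if $|K|=2$ and $|G|=1$, then $\sigma_i(I)=\infty$; (b) if $|K|=2$ and $|G|>1$, then $\sigma_i(I)=n+1$, where $n$ is the minimum index of the proper subgroups of $G$; (c) if $|K|>2$, then $\sigma_i(I)=3$. -/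

import Mathlib

universe u v w

namespace SemigroupCovering

/-- An inverse semigroup: a nonempty semigroup in which every `a` has a unique `b` with
`a b a = a` and `b a b = b`. -/
def IsInverseSemigroup (S : Type u) [Semigroup S] : Prop :=
  Nonempty S ∧ ∀ a : S, ∃! b : S, a * b * a = a ∧ b * a * b = b

/-- A semigroup that is a group: it has an identity, and every element has an inverse. -/
def IsGroupSemigroup (S : Type u) [Semigroup S] : Prop :=
  ∃ e : S, (∀ x : S, e * x = x ∧ x * e = x) ∧ ∀ x : S, ∃ y : S, x * y = e ∧ y * x = e

/-- `C` is a covering of `S` by proper subsemigroups that satisfy `p`. -/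
def IsCovering {S : Type u} [Semigroup S] (p : Subsemigroup S → Prop)
    (C : Set (Subsemigroup S)) : Prop :=
  (∀ U ∈ C, U ≠ ⊤ ∧ p U) ∧ ∀ x : S, ∃ U ∈ C, x ∈ U

/-- The least number of proper subsemigroups satisfying `p` whose union is `S`; it is `⊤`
if there is no finite covering of this kind. -/
noncomputable def coveringNumber (S : Type u) [Semigroup S] (p : Subsemigroup S → Prop) : ℕ∞ :=
  sInf {n : ℕ∞ | ∃ C : Set (Subsemigroup S), IsCovering p C ∧ C.encard = n}

/-- The covering number with respect to (proper) inverse subsemigroups, that is, subsemigroups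
that are inverse semigroups themselves. -/
noncomputable def sigmaI (S : Type u) [Semigroup S] : ℕ∞ :=
  coveringNumber S fun U => IsInverseSemigroup U

/-- The covering number with respect to (proper) subgroups, that is, subsemigroups that are
groups themselves. -/
noncomputable def sigmaG (S : Type u) [Semigroup S] : ℕ∞ :=
  coveringNumber S fun U => IsGroupSemigroup U

/-- The principal ideal `S¹ x S¹`. Adjoining a further identity to a semigroup that already
has one does not change this set. -/
def principalIdeal {S : Type u} [Semigroup S] (x : S) : Set S :=
  {y | ∃ a b : WithOne S, (y : WithOne S) = a * (x : WithOne S) * b}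

/-- Green's relation `𝒥`. -/
def GreenJ {S : Type u} [Semigroup S] (x y : S) : Prop :=
  principalIdeal x = principalIdeal y

/-- `J` is a `𝒥`-class of `S`. -/
def IsJClass {S : Type u} [Semigroup S] (J : Set S) : Prop :=
  ∃ x : S, J = {y | GreenJ y x}

/-- The elements of the principal factor `J* = J ∪ {0}`. -/
inductive PrincipalFactor {S : Type u} (J : Set S) : Type u
  | zero : PrincipalFactor J
  | of (s : J) : PrincipalFactor J

open Classical in
/-- Products in `J*` are those of `S` when they stay inside `J`, and `0` otherwise. -/
noncomputable instance PrincipalFactor.instMul {S : Type u} [Semigroup S] (J : Set S) :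
    Mul (PrincipalFactor J) where
  mul
    | .of s, .of t => if h : (s : S) * (t : S) ∈ J then .of ⟨(s : S) * (t : S), h⟩ else .zero
    | _, _ => .zero

/-- The elements of the Rees 0-matrix semigroup `ℳ⁰[K, G, Λ; P]`: the set
`(K × G × Λ) ∪ {0}`. -/
inductive ReesZeroMatrix {K : Type u} {G : Type v} {Λ : Type w}
    (P : Matrix Λ K (WithZero G)) : Type (max u v w)
  | zero : ReesZeroMatrix P
  | triple (κ : K) (g : G) (l : Λ) : ReesZeroMatrix P

/-- The triple `(κ, x, l)` for `x` in `G ∪ {0}`, read as `0` when `x = 0`. -/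
def ReesZeroMatrix.ofEntry {K : Type u} {G : Type v} {Λ : Type w}
    (P : Matrix Λ K (WithZero G)) (κ : K) (x : WithZero G) (l : Λ) : ReesZeroMatrix P :=
  WithZero.recZeroCoe (motive := fun _ => ReesZeroMatrix P) .zero (fun g => .triple κ g l) x

/-- `(κ, g, l)(μ, h, ν) = (κ, g p_{l,μ} h, ν)` when `p_{l,μ} ≠ 0`; all other products are `0`. -/
instance ReesZeroMatrix.instMul {K : Type u} {G : Type v} {Λ : Type w} [Group G]
    (P : Matrix Λ K (WithZero G)) : Mul (ReesZeroMatrix P) where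
  mul
    | .triple κ g l, .triple μ h ν =>
        ReesZeroMatrix.ofEntry P κ ((g : WithZero G) * P l μ * (h : WithZero G)) ν
    | _, _ => .zero

/-- `n` is the minimum index of the proper subgroups of `G`. -/
def IsMinProperIndex (G : Type u) [Group G] (n : ℕ) : Prop :=
  IsLeast {k : ℕ | ∃ H : Subgroup G, H ≠ ⊤ ∧ H.index = k} n

end SemigroupCovering

open SemigroupCovering

/-! A `𝒥`-class `J` of a finite inverse semigroup is a connected groupoid: its elements are arrows
`(i, g, j)` with objects in `K` and vertex group `G`, and a product of two arrows stays in `J`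
exactly when the middle objects agree (`BrandtCoordinates`). If `J` generates, it is the top
`𝒥`-class, so its complement is absorbed by products. Hence every subgroupoid of `J`, enlarged by
the complement, is an inverse subsemigroup (`BrandtCoordinates.sub`), and a proper inverse
subsemigroup must miss an arrow. The problem becomes that of covering a connected groupoid by proper
subgroupoids.

Two never suffice, as for groups (`three_le_sigmaI`). With three objects or more, three suffice,
because an arrow has at most two endpoints. With two objects `a`, `b` and trivial `G`, an arrow from
`a` to `b` generates everything. With two objects and nontrivial `G`, a proper subgroupoid
containing some `a → b` arrow has a proper vertex group `H` at `a`, and its `a → b` arrows form a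
coset of `H`. So at least `n` of these are needed for the `a → b` arrows; exactly `n` would all
share the identity at `a` and be too small to cover the vertex group
(`IsMinProperIndex.lt_card_of_covers`). Conversely, the cosets of a subgroup of index `n`, plus the
groupoid of loops, give `n + 1`.

If no `𝒥`-class generates, a maximal class yields two pieces: what it generates, and its complement.
In a group, inverse subsemigroups are subgroups. -/

namespace SemigroupCovering

/-! ### Elementary theory of inverse semigroups -/

section Inverse

variable {S : Type u} [Semigroup S]

/-- The inverse of an element of an inverse semigroup. -/
noncomputable def IsInverseSemigroup.inv (hS : IsInverseSemigroup S) (a : S) : S :=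
  (hS.2 a).choose

theorem IsInverseSemigroup.mul_inv_mul (hS : IsInverseSemigroup S) (a : S) : a * hS.inv a * a = a :=
  (hS.2 a).choose_spec.1.1

theorem IsInverseSemigroup.inv_mul_inv (hS : IsInverseSemigroup S)
    (a : S) : hS.inv a * a * hS.inv a = hS.inv a :=
  (hS.2 a).choose_spec.1.2

theorem IsInverseSemigroup.eq_inv (hS : IsInverseSemigroup S)
    {a b : S} (h₁ : a * b * a = a) (h₂ : b * a * b = b) :
    b = hS.inv a :=
  (hS.2 a).unique ⟨h₁, h₂⟩ (hS.2 a).choose_spec.1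

theorem IsInverseSemigroup.inv_inv (hS : IsInverseSemigroup S) (a : S) : hS.inv (hS.inv a) = a :=
  (hS.eq_inv (hS.inv_mul_inv a) (hS.mul_inv_mul a)).symm

theorem IsInverseSemigroup.inv_of_idem (hS : IsInverseSemigroup S)
    {e : S} (he : e * e = e) : hS.inv e = e :=
  (hS.eq_inv (by rw [he, he]) (by rw [he, he])).symm

/-- With `x` the inverse of `e * f`, the element `f * x * e` is an inverse too, so it equals `x`.
This makes `x` idempotent, hence its own inverse, so `x = e * f`. -/
theorem IsInverseSemigroup.idem_mul (hS : IsInverseSemigroup S)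
    {e f : S} (he : e * e = e) (hf : f * f = f) :
    e * f * (e * f) = e * f := by
  have h1 := hS.mul_inv_mul (e * f)
  have h2 := hS.inv_mul_inv (e * f)
  set x := hS.inv (e * f) with hx
  have h3 : f * x * e = x := by
    refine hS.eq_inv ?_ ?_
    · calc e * f * (f * x * e) * (e * f) = e * (f * f) * x * (e * e) * f := by
            simp only [mul_assoc]
        _ = e * f * x * (e * f) := by rw [he, hf]; simp only [mul_assoc]
        _ = e * f := h1
    · calc f * x * e * (e * f) * (f * x * e) = f * x * (e * e) * (f * f) * x * e := by
            simp only [mul_assoc]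
        _ = f * (x * (e * f) * x) * e := by rw [he, hf]; simp only [mul_assoc]
        _ = f * x * e := by rw [h2]
  have h4 : x * x = x := by
    calc x * x = (f * x * e) * (f * x * e) := by rw [h3]
      _ = f * (x * (e * f) * x) * e := by simp only [mul_assoc]
      _ = x := by rw [h2, h3]
  have h5 : x = e * f := by
    rw [← hS.inv_of_idem h4, hx, hS.inv_inv]
  rw [← h5, h4]

/-- Both `f * e` and the idempotent `e * f` itself are inverses of `e * f`. -/
theorem IsInverseSemigroup.idem_comm (hS : IsInverseSemigroup S)
    {e f : S} (he : e * e = e) (hf : f * f = f) :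
    e * f = f * e := by
  have h1 := hS.idem_mul he hf
  have h2 := hS.idem_mul hf he
  rw [← hS.inv_of_idem h1]
  refine (hS.eq_inv ?_ ?_).symm
  · calc e * f * (f * e) * (e * f) = e * (f * f) * (e * e) * f := by simp only [mul_assoc]
      _ = e * f := by rw [he, hf]; simpa only [mul_assoc] using h1
  · calc f * e * (e * f) * (f * e) = f * (e * e) * (f * f) * e := by simp only [mul_assoc]
      _ = f * e := by rw [he, hf]; simpa only [mul_assoc] using h2

theorem IsInverseSemigroup.mul_inv_idem (hS : IsInverseSemigroup S) (a : S) :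
    a * hS.inv a * (a * hS.inv a) = a * hS.inv a := by
  rw [← mul_assoc, hS.mul_inv_mul]

theorem IsInverseSemigroup.inv_mul_idem (hS : IsInverseSemigroup S) (a : S) :
    hS.inv a * a * (hS.inv a * a) = hS.inv a * a := by
  rw [← mul_assoc, hS.inv_mul_inv]

theorem IsInverseSemigroup.inv_mem (hS : IsInverseSemigroup S)
    {U : Subsemigroup S} (hU : IsInverseSemigroup U) {a : S}
    (ha : a ∈ U) : hS.inv a ∈ U := by
  have h1 := congrArg Subtype.val (hU.mul_inv_mul ⟨a, ha⟩)
  have h2 := congrArg Subtype.val (hU.inv_mul_inv ⟨a, ha⟩)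
  rw [← hS.eq_inv h1 h2]
  exact (hU.inv _).2

theorem IsInverseSemigroup.of_inv_mem (hS : IsInverseSemigroup S)
    {U : Subsemigroup S} (hne : ∃ x, x ∈ U)
    (h : ∀ a ∈ U, hS.inv a ∈ U) : IsInverseSemigroup U := by
  obtain ⟨x, hx⟩ := hne
  refine ⟨⟨x, hx⟩, fun a => ⟨⟨hS.inv a, h a a.2⟩, ⟨?_, ?_⟩, ?_⟩⟩
  · exact Subtype.ext (hS.mul_inv_mul a)
  · exact Subtype.ext (hS.inv_mul_inv a)
  · rintro ⟨b, hb⟩ ⟨h1, h2⟩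
    exact Subtype.ext (hS.eq_inv (congrArg Subtype.val h1) (congrArg Subtype.val h2))

theorem IsInverseSemigroup.inv_mul_rev (hS : IsInverseSemigroup S) (a b : S) :
    hS.inv (a * b) = hS.inv b * hS.inv a := by
  have hc := hS.idem_comm (hS.mul_inv_idem b) (hS.inv_mul_idem a)
  refine (hS.eq_inv ?_ ?_).symm
  · calc a * b * (hS.inv b * hS.inv a) * (a * b)
        = a * (b * hS.inv b * (hS.inv a * a)) * b := by simp only [mul_assoc]
      _ = (a * hS.inv a * a) * (b * hS.inv b * b) := by rw [hc]; simp only [mul_assoc]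
      _ = a * b := by rw [hS.mul_inv_mul, hS.mul_inv_mul]
  · calc hS.inv b * hS.inv a * (a * b) * (hS.inv b * hS.inv a)
        = hS.inv b * (hS.inv a * a * (b * hS.inv b)) * hS.inv a := by simp only [mul_assoc]
      _ = (hS.inv b * b * hS.inv b) * (hS.inv a * a * hS.inv a) := by
          rw [← hc]; simp only [mul_assoc]
      _ = hS.inv b * hS.inv a := by rw [hS.inv_mul_inv, hS.inv_mul_inv]

end Inverse

/-! ### Groups -/

section GroupCase

variable {S : Type u} [Semigroup S]

theorem IsGroupSemigroup.isInverseSemigroup (h : IsGroupSemigroup S) : IsInverseSemigroup S := by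
  obtain ⟨e, he, hinv⟩ := h
  refine ⟨⟨e⟩, fun a => ?_⟩
  obtain ⟨b, hab, hba⟩ := hinv a
  refine ⟨b, ⟨by rw [hab, (he a).1], by rw [hba, (he b).1]⟩, ?_⟩
  rintro c ⟨hc, -⟩
  calc c = (b * a) * c * (a * b) := by rw [hba, hab, (he c).1, (he c).2]
    _ = b * (a * c * a) * b := by simp only [mul_assoc]
    _ = b := by rw [hc, hba, (he b).1]

theorem IsGroupSemigroup.subsemigroup_iff (h : IsGroupSemigroup S) (U : Subsemigroup S) :
    IsInverseSemigroup U ↔ IsGroupSemigroup U := by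
  refine ⟨fun hU => ?_, IsGroupSemigroup.isInverseSemigroup⟩
  obtain ⟨e, he, hinv⟩ := h
  have hl : ∀ a : U, (a : S) * hU.inv a = e ∧ (hU.inv a : S) * a = e := by
    intro a
    have h1 : (a : S) * hU.inv a * a = a := congrArg Subtype.val (hU.mul_inv_mul a)
    obtain ⟨b, hab, hba⟩ := hinv a
    constructor
    · calc (a : S) * hU.inv a = (a : S) * hU.inv a * (a * b) := by rw [hab, (he _).2]
        _ = e := by rw [← mul_assoc, h1, hab]
    · calc (hU.inv a : S) * a = b * a * (hU.inv a * a) := by rw [hba, (he _).1]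
        _ = b * ((a : S) * hU.inv a * a) := by simp only [mul_assoc]
        _ = e := by rw [h1, hba]
  obtain ⟨u⟩ := hU.1
  have heU : e ∈ U := (hl u).1 ▸ U.mul_mem u.2 (hU.inv u).2
  exact ⟨⟨e, heU⟩, fun x => ⟨Subtype.ext (he x).1, Subtype.ext (he x).2⟩,
    fun x => ⟨hU.inv x, Subtype.ext (hl x).1, Subtype.ext (hl x).2⟩⟩

theorem IsGroupSemigroup.sigmaI_eq_sigmaG (h : IsGroupSemigroup S) : sigmaI S = sigmaG S := by
  have : (fun U : Subsemigroup S => IsInverseSemigroup U) =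
      fun U : Subsemigroup S => IsGroupSemigroup U :=
    funext fun U => propext (h.subsemigroup_iff U)
  rw [sigmaI, sigmaG, this]

end GroupCase

/-! ### General bounds for covering numbers -/

section CoveringNumber

variable {S : Type u} [Semigroup S] {p : Subsemigroup S → Prop}

theorem coveringNumber_le {C : Set (Subsemigroup S)} (hC : IsCovering p C) :
    coveringNumber S p ≤ C.encard :=
  sInf_le ⟨C, hC, rfl⟩

theorem le_coveringNumber {m : ℕ∞} (h : ∀ C : Set (Subsemigroup S), IsCovering p C → m ≤ C.encard) :
    m ≤ coveringNumber S p := by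
  refine le_sInf ?_
  rintro _ ⟨C, hC, rfl⟩
  exact h C hC

theorem two_le_coveringNumber [Nonempty S] : 2 ≤ coveringNumber S p := by
  refine le_coveringNumber fun C hC => ?_
  by_contra hlt
  have h1 : C.encard ≤ 1 := by
    have : C.encard < 1 + 1 := by rw [one_add_one_eq_two]; exact not_le.1 hlt
    exact Order.le_of_lt_add_one this
  obtain ⟨x⟩ := ‹Nonempty S›
  obtain ⟨U, hU, -⟩ := hC.2 x
  refine (hC.1 U hU).1 (top_le_iff.1 fun y _ => ?_)
  obtain ⟨V, hV, hy⟩ := hC.2 y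
  rwa [Set.encard_le_one_iff.1 h1 U V hU hV]

theorem three_le_coveringNumber [Nonempty S]
    (h : ∀ U V : Subsemigroup S, U ≠ ⊤ → V ≠ ⊤ → p U → p V → ∃ x, x ∉ U ∧ x ∉ V) :
    3 ≤ coveringNumber S p := by
  refine le_coveringNumber fun C hC => ?_
  have h2 : 2 ≤ C.encard := two_le_coveringNumber.trans (coveringNumber_le hC)
  have h3 : C.encard ≠ 2 := by
    intro h2
    obtain ⟨U, V, -, rfl⟩ := Set.encard_eq_two.1 h2
    have hU := hC.1 U (by simp)
    have hV := hC.1 V (by simp)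
    obtain ⟨x, hxU, hxV⟩ := h U V hU.1 hV.1 hU.2 hV.2
    obtain ⟨W, hW, hx⟩ := hC.2 x
    rcases hW with rfl | rfl
    · exact hxU hx
    · exact hxV hx
  have := Order.add_one_le_of_lt (lt_of_le_of_ne h2 h3.symm)
  rwa [show (2 : ℕ∞) + 1 = 3 by norm_num] at this

end CoveringNumber

/-! ### Maximal `𝒥`-classes and the case of no generating class -/

section Green

variable {S : Type u} [Semigroup S]

theorem mem_principalIdeal_self (x : S) : x ∈ principalIdeal x := ⟨1, 1, by simp⟩

theorem mul_mul_mem_principalIdeal (a x b : S) : a * x * b ∈ principalIdeal x :=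
  ⟨a, b, by simp⟩

theorem mul_left_mem_principalIdeal (a x : S) : a * x ∈ principalIdeal x := ⟨a, 1, by simp⟩

theorem mul_right_mem_principalIdeal (x b : S) : x * b ∈ principalIdeal x := ⟨1, b, by simp⟩

theorem principalIdeal_subset {x y : S} (h : x ∈ principalIdeal y) :
    principalIdeal x ⊆ principalIdeal y := by
  obtain ⟨a, b, hx⟩ := h
  rintro z ⟨c, d, hz⟩
  exact ⟨c * a, b * d, by rw [hz, hx]; simp only [mul_assoc]⟩

theorem greenJ_iff {x y : S} : GreenJ x y ↔ x ∈ principalIdeal y ∧ y ∈ principalIdeal x := by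
  constructor
  · intro h
    have h' : principalIdeal x = principalIdeal y := h
    exact ⟨h' ▸ mem_principalIdeal_self x, h' ▸ mem_principalIdeal_self y⟩
  · rintro ⟨h1, h2⟩
    exact Set.Subset.antisymm (principalIdeal_subset h1) (principalIdeal_subset h2)

/-- The adjoined identity is dispensable because `y * y⁻¹` and `y⁻¹ * y` act as local identities on
`y`. -/
theorem IsInverseSemigroup.exists_of_mem_principalIdeal (hS : IsInverseSemigroup S) {x y : S}
    (h : x ∈ principalIdeal y) : ∃ a b, x = a * y * b := by
  obtain ⟨a, b, hx⟩ := h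
  have hy : y * hS.inv y * y * (hS.inv y * y) = y := by
    rw [hS.mul_inv_mul, ← mul_assoc, hS.mul_inv_mul]
  rcases eq_or_ne a 1 with rfl | ha <;> rcases eq_or_ne b 1 with rfl | hb
  · refine ⟨y * hS.inv y, hS.inv y * y, ?_⟩
    rw [hy]
    exact WithOne.coe_injective (by simpa using hx)
  · obtain ⟨b, rfl⟩ := WithOne.ne_one_iff_exists.1 hb
    refine ⟨y * hS.inv y, b, ?_⟩
    rw [hS.mul_inv_mul]
    exact WithOne.coe_injective (by simpa using hx)
  · obtain ⟨a, rfl⟩ := WithOne.ne_one_iff_exists.1 ha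
    refine ⟨a, hS.inv y * y, ?_⟩
    rw [mul_assoc, ← mul_assoc y, hS.mul_inv_mul]
    exact WithOne.coe_injective (by simpa using hx)
  · obtain ⟨a, rfl⟩ := WithOne.ne_one_iff_exists.1 ha
    obtain ⟨b, rfl⟩ := WithOne.ne_one_iff_exists.1 hb
    exact ⟨a, b, WithOne.coe_injective (by simpa using hx)⟩

/-- `J` is a `𝒥`-class that is maximal in the order of the `𝒥`-classes. -/
def IsMaximalJClass (J : Set S) : Prop :=
  ∃ x : S, J = {y | GreenJ y x} ∧ ∀ y, x ∈ principalIdeal y → GreenJ y x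

theorem IsJClass.greenJ {J : Set S} (hJ : IsJClass J) {x y : S} (hx : x ∈ J) (hy : y ∈ J) :
    GreenJ x y := by
  obtain ⟨z, rfl⟩ := hJ
  exact Eq.trans hx (Eq.symm hy)

theorem IsJClass.mem_of_greenJ {J : Set S} (hJ : IsJClass J) {x y : S} (hx : x ∈ J)
    (h : GreenJ y x) : y ∈ J := by
  obtain ⟨z, rfl⟩ := hJ
  exact Eq.trans h hx

theorem IsMaximalJClass.isJClass {J : Set S} (hJ : IsMaximalJClass J) : IsJClass J := by
  obtain ⟨x, hx, -⟩ := hJ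
  exact ⟨x, hx⟩

/-- Factors lie `𝒥`-above their product, so maximality keeps them in the class; thus the complement
absorbs products. -/
theorem IsMaximalJClass.mem_of_mul_mem {J : Set S} (hJ : IsMaximalJClass J) {a b : S}
    (h : a * b ∈ J) : a ∈ J ∧ b ∈ J := by
  obtain ⟨x, rfl, hx⟩ := hJ
  have h' := (greenJ_iff.1 h).2
  exact ⟨hx a (principalIdeal_subset (mul_right_mem_principalIdeal a b) h'),
    hx b (principalIdeal_subset (mul_left_mem_principalIdeal a b) h')⟩

theorem exists_isMaximalJClass [Finite S] [Nonempty S] : ∃ J : Set S, IsMaximalJClass J := by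
  obtain ⟨x, hx⟩ := Finite.exists_max fun x : S => (principalIdeal x).ncard
  refine ⟨_, x, rfl, fun y hy => ?_⟩
  -- A principal ideal of largest cardinality is not properly contained in another one.
  exact (Set.eq_of_subset_of_ncard_le (principalIdeal_subset hy) (hx y) (Set.toFinite _)).symm

theorem IsJClass.isMaximalJClass {J : Set S} (hJ : IsJClass J)
    (hgen : Subsemigroup.closure J = ⊤) : IsMaximalJClass J := by
  obtain ⟨x, rfl⟩ := hJ
  have hall : ∀ z : S, z ∈ principalIdeal x := by
    intro z
    have hz : z ∈ Subsemigroup.closure {y | GreenJ y x} := hgen ▸ Subsemigroup.mem_top z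
    induction hz using Subsemigroup.closure_induction with
    | mem y hy => exact (greenJ_iff.1 hy).1
    | mul a b _ _ ha _ => exact principalIdeal_subset ha (mul_right_mem_principalIdeal a b)
  exact ⟨x, rfl, fun y hy => greenJ_iff.2 ⟨hall y, hy⟩⟩

theorem IsJClass.nonempty {J : Set S} (hJ : IsJClass J) : J.Nonempty := by
  obtain ⟨x, rfl⟩ := hJ
  exact ⟨x, rfl⟩

theorem IsInverseSemigroup.greenJ_inv (hS : IsInverseSemigroup S) (x : S) :
    GreenJ (hS.inv x) x := by
  refine greenJ_iff.2 ⟨?_, ?_⟩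
  · have := mul_mul_mem_principalIdeal (hS.inv x) x (hS.inv x)
    rwa [hS.inv_mul_inv] at this
  · have := mul_mul_mem_principalIdeal x (hS.inv x) x
    rwa [hS.mul_inv_mul] at this

theorem IsInverseSemigroup.greenJ_mul_inv (hS : IsInverseSemigroup S) (x : S) :
    GreenJ (x * hS.inv x) x := by
  refine greenJ_iff.2 ⟨mul_right_mem_principalIdeal _ _, ?_⟩
  have := mul_right_mem_principalIdeal (x * hS.inv x) x
  rwa [hS.mul_inv_mul] at this

theorem IsJClass.inv_mem (hS : IsInverseSemigroup S) {J : Set S} (hJ : IsJClass J) {x : S}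
    (hx : x ∈ J) : hS.inv x ∈ J :=
  hJ.mem_of_greenJ hx (hS.greenJ_inv x)

theorem IsJClass.inv_not_mem (hS : IsInverseSemigroup S) {J : Set S} (hJ : IsJClass J) {x : S}
    (hx : x ∉ J) : hS.inv x ∉ J := by
  intro h
  have := hJ.inv_mem hS h
  rw [hS.inv_inv] at this
  exact hx this

theorem sigmaI_eq_two [Finite S] (hS : IsInverseSemigroup S)
    (h : ¬ ∃ J : Set S, IsJClass J ∧ Subsemigroup.closure J = ⊤) : sigmaI S = 2 := by
  have := hS.1
  refine le_antisymm ?_ two_le_coveringNumber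
  obtain ⟨J, hmax⟩ := exists_isMaximalJClass (S := S)
  have hJ := hmax.isJClass
  have hcl : Subsemigroup.closure J ≠ ⊤ := fun hc => h ⟨J, hJ, hc⟩
  let V : Subsemigroup S :=
    { carrier := Jᶜ
      mul_mem' := fun {a b} ha _ hab => ha (hmax.mem_of_mul_mem hab).1 }
  have hcov : IsCovering (fun U : Subsemigroup S => IsInverseSemigroup U)
      {Subsemigroup.closure J, V} := by
    constructor
    · rintro U (rfl | rfl)
      · refine ⟨hcl, hS.of_inv_mem ?_ fun a ha => ?_⟩
        · obtain ⟨x, hx⟩ := hJ.nonempty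
          exact ⟨x, Subsemigroup.subset_closure hx⟩
        · induction ha using Subsemigroup.closure_induction with
          | mem y hy => exact Subsemigroup.subset_closure (hJ.inv_mem hS hy)
          | mul a b _ _ ha hb => rw [hS.inv_mul_rev]; exact Subsemigroup.mul_mem _ hb ha
      · refine ⟨fun hV => ?_, hS.of_inv_mem ?_ fun a ha => hJ.inv_not_mem hS ha⟩
        · obtain ⟨x, hx⟩ := hJ.nonempty
          have : x ∈ V := hV ▸ Subsemigroup.mem_top x
          exact this hx
        -- If the complement were empty, `J` would be everything and would generate.
        · by_contra! hne
          exact hcl (top_le_iff.1 fun x _ => Subsemigroup.subset_closure (not_not.1 (hne x)))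
    · intro x
      by_cases hx : x ∈ J
      · exact ⟨_, by simp, Subsemigroup.subset_closure hx⟩
      · exact ⟨V, by simp, hx⟩
  exact (coveringNumber_le hcov).trans ((Set.encard_insert_le _ _).trans
    (by rw [Set.encard_singleton, one_add_one_eq_two]))

end Green

/-! ### Groupoid coordinates and the coverings they give -/

/-- Coordinates in a Brandt semigroup for the elements of a `𝒥`-class. -/
structure BrandtCoordinates {S : Type u} [Semigroup S] (J : Set S) (K : Type v) (G : Type w)
    [Group G] where
  /-- The element with the given coordinates. -/
  toFun : K → G → K → S
  inj : ∀ {i g j k h l}, toFun i g j = toFun k h l → i = k ∧ g = h ∧ j = l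
  mem : ∀ i g j, toFun i g j ∈ J
  surj : ∀ x ∈ J, ∃ i g j, toFun i g j = x
  mul : ∀ i g j h l, toFun i g j * toFun j h l = toFun i (g * h) l
  mul_not_mem : ∀ i g j k h l, j ≠ k → toFun i g j * toFun k h l ∉ J

namespace BrandtCoordinates

variable {S : Type u} [Semigroup S] {J : Set S} {K : Type v} {G : Type w} [Group G]

theorem inv_eq (c : BrandtCoordinates J K G) (hS : IsInverseSemigroup S) (i : K) (g : G) (j : K) :
    hS.inv (c.toFun i g j) = c.toFun j g⁻¹ i := by
  refine (hS.eq_inv ?_ ?_).symm <;> simp [c.mul]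

theorem inv_mem (c : BrandtCoordinates J K G) (hS : IsInverseSemigroup S) {U : Subsemigroup S}
    (hU : IsInverseSemigroup U) {i : K} {g : G} {j : K} (h : c.toFun i g j ∈ U) :
    c.toFun j g⁻¹ i ∈ U :=
  c.inv_eq hS i g j ▸ hS.inv_mem hU h

theorem finite_index [Finite S] (c : BrandtCoordinates J K G) : Finite K :=
  Finite.of_injective (fun i => c.toFun i 1 i) fun _ _ h => (c.inj h).1

theorem finite_group [Finite S] (c : BrandtCoordinates J K G) [Nonempty K] : Finite G := by
  obtain ⟨k⟩ := ‹Nonempty K›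
  exact Finite.of_injective (fun g => c.toFun k g k) fun _ _ h => (c.inj h).2.1

theorem eq_top (c : BrandtCoordinates J K G) (hgen : Subsemigroup.closure J = ⊤)
    {U : Subsemigroup S} (h : ∀ i g j, c.toFun i g j ∈ U) : U = ⊤ := by
  rw [eq_top_iff, ← hgen, Subsemigroup.closure_le]
  intro x hx
  obtain ⟨i, g, j, rfl⟩ := c.surj x hx
  exact h i g j

/-- With a single object all arrows compose, so `J` is closed under products and the whole semigroup
is a copy of `G`. -/
theorem two_le_card [Finite S] (c : BrandtCoordinates J K G) (hne : J.Nonempty)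
    (hgen : Subsemigroup.closure J = ⊤) (hgr : ¬ IsGroupSemigroup S) : 2 ≤ Nat.card K := by
  have := c.finite_index
  obtain ⟨x, hx⟩ := hne
  obtain ⟨k, -⟩ := c.surj x hx
  by_contra hlt
  have hsub : Subsingleton K := by
    rw [← Finite.card_le_one_iff_subsingleton]; omega
  have hall : ∀ y : S, ∃ g, c.toFun k g k = y := by
    intro y
    have hy : y ∈ Subsemigroup.closure J := hgen ▸ Subsemigroup.mem_top y
    induction hy using Subsemigroup.closure_induction with
    | mem y hy =>
      obtain ⟨i, g, j, rfl⟩ := c.surj y hy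
      exact ⟨g, by rw [Subsingleton.elim i k, Subsingleton.elim j k]⟩
    | mul a b _ _ ha hb =>
      obtain ⟨g, rfl⟩ := ha
      obtain ⟨h, rfl⟩ := hb
      exact ⟨g * h, (c.mul _ _ _ _ _).symm⟩
  refine hgr ⟨c.toFun k 1 k, fun y => ?_, fun y => ?_⟩
  · obtain ⟨g, rfl⟩ := hall y
    simp [c.mul]
  · obtain ⟨g, rfl⟩ := hall y
    exact ⟨c.toFun k g⁻¹ k, by simp [c.mul]⟩

/-- The elements outside `J` together with those elements of `J` whose coordinates satisfy `A`. -/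
def sub (c : BrandtCoordinates J K G) (hmax : IsMaximalJClass J) (A : K → G → K → Prop)
    (hA : ∀ i g j h k, A i g j → A j h k → A i (g * h) k) : Subsemigroup S where
  carrier := {x | ∀ i g j, c.toFun i g j = x → A i g j}
  mul_mem' := by
    intro x y hx hy i g j hxy
    have hmem := hmax.mem_of_mul_mem (hxy ▸ c.mem i g j)
    obtain ⟨i₁, g₁, j₁, rfl⟩ := c.surj x hmem.1
    obtain ⟨i₂, g₂, j₂, rfl⟩ := c.surj y hmem.2
    have hj : j₁ = i₂ := by
      by_contra hne
      exact c.mul_not_mem i₁ g₁ j₁ i₂ g₂ j₂ hne (hxy ▸ c.mem i g j)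
    subst hj
    rw [c.mul] at hxy
    obtain ⟨rfl, rfl, rfl⟩ := c.inj hxy
    exact hA _ _ _ _ _ (hx _ _ _ rfl) (hy _ _ _ rfl)

variable {A : K → G → K → Prop} {hA : ∀ i g j h k, A i g j → A j h k → A i (g * h) k}
  {hmax : IsMaximalJClass J}

theorem mem_sub (c : BrandtCoordinates J K G) {i : K} {g : G} {j : K} :
    c.toFun i g j ∈ c.sub hmax A hA ↔ A i g j := by
  refine ⟨fun h => h _ _ _ rfl, fun h k g' l he => ?_⟩
  obtain ⟨rfl, rfl, rfl⟩ := c.inj he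
  exact h

theorem mem_sub_of_not_mem (c : BrandtCoordinates J K G) {x : S} (hx : x ∉ J) :
    x ∈ c.sub hmax A hA :=
  fun i g j he => (hx (he ▸ c.mem i g j)).elim

theorem sub_ne_top (c : BrandtCoordinates J K G) {i : K} {g : G} {j : K} (h : ¬ A i g j) :
    c.sub hmax A hA ≠ ⊤ :=
  fun he => h (c.mem_sub.1 (he ▸ Subsemigroup.mem_top (c.toFun i g j)))

theorem isInverseSemigroup_sub (c : BrandtCoordinates J K G) (hS : IsInverseSemigroup S)
    (hinv : ∀ i g j, A i g j → A j g⁻¹ i) (hK : 2 ≤ Nat.card K) :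
    IsInverseSemigroup (c.sub hmax A hA) := by
  have : Finite K := Nat.finite_of_card_ne_zero (by omega)
  have : Nontrivial K := Finite.one_lt_card_iff_nontrivial.1 hK
  obtain ⟨a, b, hab⟩ := exists_pair_ne K
  -- A product of non-composable arrows lies outside `J`, so the subsemigroup is nonempty whatever
  -- `A` is.
  refine hS.of_inv_mem ⟨_, c.mem_sub_of_not_mem (c.mul_not_mem a 1 a b 1 b hab)⟩ fun x hx => ?_
  by_cases hxJ : x ∈ J
  · obtain ⟨i, g, j, rfl⟩ := c.surj x hxJ
    rw [c.inv_eq hS]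
    exact c.mem_sub.2 (hinv _ _ _ (c.mem_sub.1 hx))
  · exact c.mem_sub_of_not_mem (hmax.isJClass.inv_not_mem hS hxJ)

theorem mem_of_left (c : BrandtCoordinates J K G) (hS : IsInverseSemigroup S)
    {U : Subsemigroup S} (hU : IsInverseSemigroup U) {i j l : K} {g h : G}
    (h₁ : c.toFun i g j ∈ U) (h₂ : c.toFun i (g * h) l ∈ U) : c.toFun j h l ∈ U := by
  have := U.mul_mem (c.inv_mem hS hU h₁) h₂
  rwa [c.mul, inv_mul_cancel_left] at this

theorem mem_of_right (c : BrandtCoordinates J K G) (hS : IsInverseSemigroup S)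
    {U : Subsemigroup S} (hU : IsInverseSemigroup U) {i j l : K} {g h : G}
    (h₁ : c.toFun j h l ∈ U) (h₂ : c.toFun i (g * h) l ∈ U) : c.toFun i g j ∈ U := by
  have := U.mul_mem h₂ (c.inv_mem hS hU h₁)
  rwa [c.mul, mul_inv_cancel_right] at this

/-- Take arrows `x ∉ V` and `y ∉ U` and join them by an arrow `z` with label `1`. As for groups, one
asks where `x * z * y` lies. If `z ∈ U`, then `z * y` and `x * z * y` miss `U`, hence lie in `V`,
which forces `x ∈ V`. If `z ∉ U`, the same argument applies with `x * z` in place of `x`. -/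
theorem three_le_sigmaI (c : BrandtCoordinates J K G) (hS : IsInverseSemigroup S)
    (hgen : Subsemigroup.closure J = ⊤) : 3 ≤ sigmaI S := by
  have := hS.1
  refine three_le_coveringNumber fun U V hU hV hUi hVi => ?_
  by_contra! hcov
  have hex : ∀ W : Subsemigroup S, W ≠ ⊤ → ∃ i g j, c.toFun i g j ∉ W := by
    intro W hW
    by_contra! h
    exact hW (c.eq_top hgen h)
  obtain ⟨i, g, j, hx⟩ := hex V hV
  obtain ⟨k, h, l, hy⟩ := hex U hU
  have hxU : c.toFun i g j ∈ U := by_contra fun hn => hx (hcov _ hn)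
  have hyV : c.toFun k h l ∈ V := hcov _ hy
  rcases Classical.em (c.toFun j 1 k ∈ U) with hz | hz
  · have hzy : c.toFun j h l ∉ U := fun hn =>
      hy (c.mem_of_left hS hUi hz (by rwa [one_mul]))
    have hp : c.toFun i (g * h) l ∉ U := fun hn => hzy (c.mem_of_left hS hUi hxU hn)
    exact hx (c.mem_of_right hS hVi (hcov _ hzy) (hcov _ hp))
  · have hzV := hcov _ hz
    have hxz : c.toFun i g k ∉ V := fun hn =>
      hx (c.mem_of_right hS hVi hzV (by rwa [mul_one]))
    have hxzU : c.toFun i g k ∈ U := by_contra fun hn => hxz (hcov _ hn)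
    have hp : c.toFun i (g * h) l ∉ U := fun hn => hy (c.mem_of_left hS hUi hxzU hn)
    exact hxz (c.mem_of_right hS hVi hyV (hcov _ hp))

theorem sigmaI_eq_three (c : BrandtCoordinates J K G) (hS : IsInverseSemigroup S)
    (hmax : IsMaximalJClass J) (hgen : Subsemigroup.closure J = ⊤) (hK : 2 < Nat.card K) :
    sigmaI S = 3 := by
  refine le_antisymm ?_ (c.three_le_sigmaI hS hgen)
  have : Finite K := Nat.finite_of_card_ne_zero (by omega)
  have := Fintype.ofFinite K
  obtain ⟨x, y, z, hxy, hxz, hyz⟩ :=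
    Fintype.two_lt_card_iff.1 (Nat.card_eq_fintype_card (α := K) ▸ hK)
  let W : (K → Prop) → Subsemigroup S := fun B =>
    c.sub hmax (fun i _ j => B i ∧ B j) fun _ _ _ _ _ h₁ h₂ => ⟨h₁.1, h₂.2⟩
  have hW : ∀ B k, ¬ B k → W B ≠ ⊤ ∧ IsInverseSemigroup (W B) := fun B k hk =>
    ⟨c.sub_ne_top (i := k) (g := 1) (j := k) fun h => hk h.1,
      c.isInverseSemigroup_sub hS (fun _ _ _ h => ⟨h.2, h.1⟩) (by omega)⟩
  -- An arrow that avoids neither `x` nor `y` has both as its endpoints; the third piece is proper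
  -- because of the object `z`.
  have hcov : IsCovering (fun U : Subsemigroup S => IsInverseSemigroup U)
      {W (· ≠ x), W (· ≠ y), W fun i => i = x ∨ i = y} := by
    constructor
    · rintro U (rfl | rfl | rfl)
      · exact hW _ x (by simp)
      · exact hW _ y (by simp)
      · exact hW _ z (by simp [hxz.symm, hyz.symm])
    · intro s
      by_cases hs : s ∈ J
      · obtain ⟨i, g, j, rfl⟩ := c.surj s hs
        by_cases h1 : i ≠ x ∧ j ≠ x
        · exact ⟨W (· ≠ x), by simp, c.mem_sub.2 h1⟩
        by_cases h2 : i ≠ y ∧ j ≠ y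
        · exact ⟨W (· ≠ y), by simp, c.mem_sub.2 h2⟩
        · exact ⟨W fun i => i = x ∨ i = y, by simp, c.mem_sub.2 (by grind)⟩
      · exact ⟨W (· ≠ x), by simp, c.mem_sub_of_not_mem hs⟩
  refine (coveringNumber_le hcov).trans ?_
  refine (Set.encard_insert_le _ _).trans ?_
  refine (add_le_add_left (Set.encard_insert_le _ _) 1).trans ?_
  rw [Set.encard_singleton]
  norm_num

theorem sigmaI_eq_top (c : BrandtCoordinates J K G) (hS : IsInverseSemigroup S)
    (hgen : Subsemigroup.closure J = ⊤) (hK : Nat.card K = 2) (hG : Nat.card G = 1) :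
    sigmaI S = ⊤ := by
  refine top_le_iff.1 (le_coveringNumber fun C hC => ?_)
  obtain ⟨a, b, hab, huniv⟩ := Nat.card_eq_two_iff.1 hK
  have hK' : ∀ i : K, i = a ∨ i = b := fun i => by
    have : i ∈ ({a, b} : Set K) := huniv ▸ Set.mem_univ i
    simpa using this
  have : Subsingleton G := (Nat.card_eq_one_iff_unique.1 hG).1
  obtain ⟨U, hU, hx⟩ := hC.2 (c.toFun a 1 b)
  obtain ⟨hne, hUi⟩ := hC.1 U hU
  have hx' := c.inv_mem hS hUi hx
  have ha := U.mul_mem hx hx'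
  have hb := U.mul_mem hx' hx
  rw [c.mul] at ha hb
  refine (hne (c.eq_top hgen fun i g j => ?_)).elim
  rcases hK' i with rfl | rfl <;> rcases hK' j with rfl | rfl
  · rwa [Subsingleton.elim g]
  · rwa [Subsingleton.elim g 1]
  · rwa [Subsingleton.elim g 1⁻¹]
  · rwa [Subsingleton.elim g]

end BrandtCoordinates

/-! ### Counting cosets in a finite group -/

section Counting

variable {G : Type w} [Group G] [Finite G]

theorem exists_isMinProperIndex (hG : 1 < Nat.card G) : ∃ n, IsMinProperIndex G n := by
  have : Nontrivial G := Finite.one_lt_card_iff_nontrivial.1 hG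
  have hne : {k : ℕ | ∃ H : Subgroup G, H ≠ ⊤ ∧ H.index = k}.Nonempty :=
    ⟨_, ⊥, bot_ne_top, rfl⟩
  exact ⟨_, Nat.sInf_mem hne, fun _ => Nat.sInf_le⟩

/-- If `D U` runs through proper subgroups of `G` that cover `G`, and sets `O U` of the same
size (or empty sets) cover `G` too, then there are more of these than the least proper index. -/
theorem IsMinProperIndex.lt_card_of_covers {n : ℕ} (hn : IsMinProperIndex G n) {ι : Type*}
    (F : Finset ι) (D O : ι → Set G)
    (hDO : ∀ U ∈ F, (O U).Nonempty →
      ∃ H : Subgroup G, H ≠ ⊤ ∧ D U = H ∧ (O U).ncard = (D U).ncard)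
    (hD : ∀ g, ∃ U ∈ F, g ∈ D U) (hO : ∀ g, ∃ U ∈ F, g ∈ O U) : n + 1 ≤ F.card := by
  classical
  have := Fintype.ofFinite G
  by_contra! hlt
  have hFn : F.card ≤ n := by omega
  obtain ⟨H₀, hH₀, hn₀⟩ := hn.1
  have hn2 : 2 ≤ n := by
    have h1 : n ≠ 1 := fun h => hH₀ (Subgroup.index_eq_one.1 (hn₀.trans h))
    have h0 : n ≠ 0 := hn₀ ▸ Subgroup.index_ne_zero_of_finite
    omega
  have hDle : ∀ U ∈ F, (O U).Nonempty → n * (D U).ncard ≤ Nat.card G := by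
    intro U hU hne
    obtain ⟨H, hH, hDH, -⟩ := hDO U hU hne
    rw [hDH, ← H.index_mul_card]
    exact Nat.mul_le_mul (hn.2 ⟨H, hH, rfl⟩) (Nat.card_coe_set_eq (H : Set G)).ge
  have hcover : ∀ (F' : Finset ι) (A : ι → Set G) (B : Set G), (∀ g ∈ B, ∃ U ∈ F', g ∈ A U) →
      B.ncard ≤ ∑ U ∈ F', (A U).ncard := by
    intro F' A B h
    have h1 : B ⊆ ↑(F'.biUnion fun U => (A U).toFinset) := by
      intro g hg
      simpa using h g hg
    calc B.ncard ≤ (F'.biUnion fun U => (A U).toFinset).card := by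
          rw [← Set.ncard_coe_finset]; exact Set.ncard_le_ncard h1 (Set.toFinite _)
      _ ≤ ∑ U ∈ F', ((A U).toFinset).card := Finset.card_biUnion_le
      _ = ∑ U ∈ F', (A U).ncard := by simp only [Set.ncard_eq_toFinset_card']
  have hN : 0 < Nat.card G := Nat.card_pos
  let F' := F.filter fun U => (O U).Nonempty
  have hOle : Nat.card G ≤ ∑ U ∈ F', (O U).ncard := by
    rw [← Set.ncard_univ]
    refine hcover _ _ _ fun g _ => ?_
    obtain ⟨U, hU, hg⟩ := hO g
    exact ⟨U, Finset.mem_filter.2 ⟨hU, g, hg⟩, hg⟩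
  -- Each nonempty `O U` has at most `|G| / n` elements, so covering `G` takes at least `n` of them;
  -- as `F` has at most `n` members, none is left over.
  have h1 : n * Nat.card G ≤ F'.card * Nat.card G := by
    calc n * Nat.card G ≤ n * ∑ U ∈ F', (O U).ncard := Nat.mul_le_mul_left _ hOle
      _ = ∑ U ∈ F', n * (O U).ncard := Finset.mul_sum _ _ _
      _ ≤ ∑ U ∈ F', Nat.card G := Finset.sum_le_sum fun U hU => by
          obtain ⟨hU, hne⟩ := Finset.mem_filter.1 hU
          obtain ⟨H, -, -, hc⟩ := hDO U hU hne
          exact hc ▸ hDle U hU hne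
      _ = F'.card * Nat.card G := by simp
  have h2 : n ≤ F'.card := Nat.le_of_mul_le_mul_right h1 hN
  have h3 : F' = F := Finset.eq_of_subset_of_card_le (Finset.filter_subset _ _) (by omega)
  have hne : ∀ U ∈ F, (O U).Nonempty := fun U hU =>
    (Finset.mem_filter.1 (show U ∈ F' from h3.symm ▸ hU)).2
  have h4 : ({1}ᶜ : Set G).ncard ≤ ∑ U ∈ F, (D U \ {1}).ncard :=
    hcover _ _ _ fun g hg => by
      obtain ⟨U, hU, hgU⟩ := hD g
      exact ⟨U, hU, hgU, hg⟩
  -- All the `D U` now share `1`. Removing it from the `n` sets leaves a cover of `|G| - 1` elements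
  -- of total size at most `|G| - n`, impossible since `n ≥ 2`.
  have h5 : ({1}ᶜ : Set G).ncard + 1 = Nat.card G := by
    have := Set.ncard_add_ncard_compl ({1} : Set G)
    rw [Set.ncard_singleton] at this
    omega
  have h6 : ∀ U ∈ F, n * (D U \ {1}).ncard + n ≤ Nat.card G := by
    intro U hU
    obtain ⟨H, -, hDH, -⟩ := hDO U hU (hne U hU)
    have h1 : (1 : G) ∈ D U := by rw [hDH]; exact H.one_mem
    have := Set.ncard_sdiff_singleton_add_one h1 (Set.toFinite _)
    calc n * (D U \ {1}).ncard + n = n * ((D U \ {1}).ncard + 1) := by ring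
      _ ≤ Nat.card G := this ▸ hDle U hU (hne U hU)
  have h7 : n * ({1}ᶜ : Set G).ncard + n * n ≤ n * Nat.card G := by
    have hF : F.card = n := by rw [h3] at h2; omega
    calc n * ({1}ᶜ : Set G).ncard + n * n
        ≤ n * ∑ U ∈ F, (D U \ {1}).ncard + ∑ U ∈ F, n := by
          gcongr; simp [hF]
      _ = ∑ U ∈ F, (n * (D U \ {1}).ncard + n) := by
          rw [Finset.sum_add_distrib, Finset.mul_sum]
      _ ≤ ∑ U ∈ F, Nat.card G := Finset.sum_le_sum h6
      _ = n * Nat.card G := by simp [hF]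
  rw [← h5] at h7
  nlinarith

end Counting

/-! ### Two objects and a nontrivial group -/

namespace BrandtCoordinates

variable {S : Type u} [Semigroup S] {J : Set S} {K : Type v} {G : Type w} [Group G]

theorem succ_le_sigmaI [Finite S] (c : BrandtCoordinates J K G) (hS : IsInverseSemigroup S)
    (hgen : Subsemigroup.closure J = ⊤) (hK : Nat.card K = 2) {n : ℕ}
    (hn : IsMinProperIndex G n) : (n : ℕ∞) + 1 ≤ sigmaI S := by
  obtain ⟨a, b, hab, huniv⟩ := Nat.card_eq_two_iff.1 hK
  have hK' : ∀ i : K, i = a ∨ i = b := fun i => by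
    have : i ∈ ({a, b} : Set K) := huniv ▸ Set.mem_univ i
    simpa using this
  have : Nonempty K := ⟨a⟩
  have := c.finite_group
  have : Finite (Subsemigroup S) :=
    Finite.of_injective _ (SetLike.coe_injective (A := Subsemigroup S))
  refine le_coveringNumber fun C hC => ?_
  have hfin : C.Finite := Set.toFinite C
  rw [hfin.encard_eq_coe_toFinset_card]
  refine mod_cast hn.lt_card_of_covers hfin.toFinset (fun U => {g | c.toFun a g a ∈ U})
    (fun U => {g | c.toFun a g b ∈ U}) ?_ ?_ ?_
  · rintro U hU ⟨x, hx⟩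
    obtain ⟨hne, hUi⟩ := hC.1 U (by simpa using hU)
    replace hx : c.toFun a x b ∈ U := hx
    have hx' := c.inv_mem hS hUi hx
    have h1 : c.toFun a 1 a ∈ U := by
      have := U.mul_mem hx hx'
      rwa [c.mul, mul_inv_cancel] at this
    let H : Subgroup G :=
      { carrier := {g | c.toFun a g a ∈ U}
        mul_mem' := fun {g h} hg hh => by
          have := U.mul_mem (Set.mem_ofPred.1 hg) (Set.mem_ofPred.1 hh)
          rwa [c.mul] at this
        one_mem' := h1
        inv_mem' := fun {g} hg => c.inv_mem hS hUi hg }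
    refine ⟨H, fun hH => ?_, rfl, ?_⟩
    · have haa : ∀ g, c.toFun a g a ∈ U := fun g => by
        have : g ∈ H := hH ▸ Subgroup.mem_top g
        exact this
      have hab' : ∀ g, c.toFun a g b ∈ U := fun g => by
        have := U.mul_mem (haa (g * x⁻¹)) hx
        rwa [c.mul, inv_mul_cancel_right] at this
      have hba : ∀ g, c.toFun b g a ∈ U := fun g => by
        have := c.inv_mem hS hUi (hab' g⁻¹)
        rwa [inv_inv] at this
      refine hne (c.eq_top hgen fun i g j => ?_)
      rcases hK' i with rfl | rfl <;> rcases hK' j with rfl | rfl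
      · exact haa g
      · exact hab' g
      · exact hba g
      · have := U.mul_mem (hba g) (hab' 1)
        rwa [c.mul, mul_one] at this
    -- The labels of the `a → b` arrows in `U` form the coset `H x`.
    · rw [← Set.ncard_image_of_injective {g | c.toFun a g a ∈ U} (mul_left_injective x)]
      congr 1
      ext g
      constructor
      · intro hg
        refine ⟨g * x⁻¹, ?_, inv_mul_cancel_right g x⟩
        have := U.mul_mem (Set.mem_ofPred.1 hg) hx'
        rwa [c.mul] at this
      · rintro ⟨h, hh, rfl⟩
        have := U.mul_mem (Set.mem_ofPred.1 hh) hx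
        rwa [c.mul] at this
  · intro g
    obtain ⟨U, hU, hg⟩ := hC.2 (c.toFun a g a)
    exact ⟨U, by simpa using hU, hg⟩
  · intro g
    obtain ⟨U, hU, hg⟩ := hC.2 (c.toFun a g b)
    exact ⟨U, by simpa using hU, hg⟩

theorem sigmaI_le_succ [Finite S] (c : BrandtCoordinates J K G) (hS : IsInverseSemigroup S)
    (hmax : IsMaximalJClass J) (hK : Nat.card K = 2) {H : Subgroup G} (hH : H ≠ ⊤) :
    sigmaI S ≤ (H.index : ℕ∞) + 1 := by
  classical
  obtain ⟨a, b, hab, huniv⟩ := Nat.card_eq_two_iff.1 hK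
  have hK' : ∀ i : K, i = a ∨ i = b := fun i => by
    have : i ∈ ({a, b} : Set K) := huniv ▸ Set.mem_univ i
    simpa using this
  have : Nonempty K := ⟨a⟩
  have := c.finite_group
  obtain ⟨x, hx⟩ : ∃ x, x ∉ H := by
    by_contra! h
    exact hH (top_le_iff.1 fun x _ => h x)
  -- Relabelling arrows by `d q` turns `W q` into the groupoid with all labels in `H`. Its `a → b`
  -- labels form the right coset `H * q.out⁻¹`; as `G ⧸ H` consists of left cosets, the label `g` is
  -- found in the piece of the class of `g⁻¹`.
  let d : G ⧸ H → K → G := fun q i => if i = a then 1 else q.out⁻¹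
  let W : G ⧸ H → Subsemigroup S := fun q =>
    c.sub hmax (fun i g j => d q i * g * (d q j)⁻¹ ∈ H) fun i g j h k h₁ h₂ => by
      have := H.mul_mem h₁ h₂
      simpa [mul_assoc] using this
  let D : Subsemigroup S := c.sub hmax (fun i _ j => i = j) fun _ _ _ _ _ => Eq.trans
  have hcov : IsCovering (fun U : Subsemigroup S => IsInverseSemigroup U)
      (insert D (Set.range W)) := by
    constructor
    · rintro U (rfl | ⟨q, rfl⟩)
      · exact ⟨c.sub_ne_top (i := a) (g := 1) (j := b) hab,
          c.isInverseSemigroup_sub hS (fun _ _ _ => Eq.symm) hK.ge⟩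
      · refine ⟨c.sub_ne_top (i := a) (g := x) (j := a) (by simpa [d] using hx),
          c.isInverseSemigroup_sub hS (fun i g j h => ?_) hK.ge⟩
        have := H.inv_mem h
        simpa [mul_assoc] using this
    · intro s
      by_cases hs : s ∈ J
      · obtain ⟨i, g, j, rfl⟩ := c.surj s hs
        have hout : ∀ y : G, y * ((y⁻¹ : G) : G ⧸ H).out ∈ H := fun y => by
          have := H.inv_mem (QuotientGroup.eq.1 (QuotientGroup.out_eq' ((y⁻¹ : G) : G ⧸ H)))
          simpa using this
        by_cases hij : i = j
        · exact ⟨D, by simp, c.mem_sub.2 hij⟩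
        rcases hK' i with rfl | rfl <;> rcases hK' j with rfl | rfl
        · exact (hij rfl).elim
        · refine ⟨W ((g⁻¹ : G) : G ⧸ H), by simp, c.mem_sub.2 ?_⟩
          simpa [d, hab.symm] using hout g
        · refine ⟨W (((g⁻¹)⁻¹ : G) : G ⧸ H), by simp, c.mem_sub.2 ?_⟩
          have := H.inv_mem (hout g⁻¹)
          simpa [d, hab.symm] using this
        · exact (hij rfl).elim
      · exact ⟨D, by simp, c.mem_sub_of_not_mem hs⟩
  refine (coveringNumber_le hcov).trans ((Set.encard_insert_le _ _).trans ?_)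
  gcongr
  rw [← Set.image_univ]
  refine (Set.encard_image_le _ _).trans ?_
  rw [Set.encard_univ, ENat.card_eq_coe_natCard]
  rfl

theorem sigmaI_eq_succ [Finite S] (c : BrandtCoordinates J K G) (hS : IsInverseSemigroup S)
    (hmax : IsMaximalJClass J) (hgen : Subsemigroup.closure J = ⊤) (hK : Nat.card K = 2)
    (hG : 1 < Nat.card G) : ∃ n : ℕ, IsMinProperIndex G n ∧ sigmaI S = (n : ℕ∞) + 1 := by
  have : Finite G := Nat.finite_of_card_ne_zero (by omega)
  obtain ⟨n, hn⟩ := exists_isMinProperIndex hG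
  obtain ⟨H, hH, hHn⟩ := hn.1
  exact ⟨n, hn, le_antisymm (hHn ▸ c.sigmaI_le_succ hS hmax hK hH)
    (c.succ_le_sigmaI hS hgen hK hn)⟩

end BrandtCoordinates

/-! ### From Rees matrix semigroups to groupoid coordinates and back -/

section Rees

theorem PrincipalFactor.of_mul_of_mem {S : Type u} [Semigroup S] {J : Set S} {s t : J}
    (h : (s : S) * t ∈ J) : of s * of t = of ⟨(s : S) * t, h⟩ :=
  dif_pos h

theorem PrincipalFactor.of_mul_of_not_mem {S : Type u} [Semigroup S] {J : Set S} {s t : J}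
    (h : (s : S) * t ∉ J) : of s * of t = zero :=
  dif_neg h

theorem PrincipalFactor.zero_mul {S : Type u} [Semigroup S] {J : Set S}
    (x : PrincipalFactor J) : zero * x = zero := rfl

theorem ReesZeroMatrix.mul_zero {K : Type v} {G : Type w} [Group G]
    {P : Matrix K K (WithZero G)} (x : ReesZeroMatrix P) : x * zero = zero := by
  cases x <;> rfl

theorem ReesZeroMatrix.triple_mul_triple {K : Type v} {G : Type w} [Group G]
    {P : Matrix K K (WithZero G)} {κ l μ ν : K} {g h p : G} (hp : P l μ = (p : WithZero G)) :
    (triple κ g l * triple μ h ν : ReesZeroMatrix P) = triple κ (g * p * h) ν := by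
  change ofEntry P κ ((g : WithZero G) * P l μ * (h : WithZero G)) ν = _
  rw [hp]
  rfl

theorem ReesZeroMatrix.triple_mul_triple_of_eq_zero {K : Type v} {G : Type w} [Group G]
    {P : Matrix K K (WithZero G)} {κ l μ ν : K} {g h : G} (hp : P l μ = 0) :
    (triple κ g l * triple μ h ν : ReesZeroMatrix P) = zero := by
  change ofEntry P κ ((g : WithZero G) * P l μ * (h : WithZero G)) ν = _
  rw [hp, MulZeroClass.mul_zero, MulZeroClass.zero_mul]
  rfl

variable {S : Type u} [Semigroup S] {J : Set S} {K : Type v} {G : Type w} [Group G]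

open Classical in
/-- A principal factor with Brandt coordinates is the Rees `0`-matrix semigroup of the identity
matrix. -/
theorem BrandtCoordinates.nonempty_mulEquiv (c : BrandtCoordinates J K G) :
    ∃ P : Matrix K K (WithZero G), Nonempty (PrincipalFactor J ≃* ReesZeroMatrix P) := by
  let P : Matrix K K (WithZero G) := fun i j => if i = j then ((1 : G) : WithZero G) else 0
  let f : ReesZeroMatrix P → PrincipalFactor J
    | .zero => .zero
    | .triple i g j => .of ⟨c.toFun i g j, c.mem i g j⟩
  have hf : ∀ x y, f (x * y) = f x * f y := by
    rintro (_ | ⟨i, g, j⟩) y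
    · rfl
    rcases y with _ | ⟨k, h, l⟩
    · rfl
    by_cases hjk : j = k
    · subst hjk
      rw [ReesZeroMatrix.triple_mul_triple (P := P) (p := (1 : G)) (if_pos rfl), mul_one]
      have hm := c.mul i g j h l
      have : c.toFun i g j * c.toFun j h l ∈ J := hm ▸ c.mem _ _ _
      exact Eq.trans (by simp only [f, hm]) (PrincipalFactor.of_mul_of_mem (J := J)
        (s := ⟨c.toFun i g j, c.mem i g j⟩) (t := ⟨c.toFun j h l, c.mem j h l⟩) this).symm
    · rw [ReesZeroMatrix.triple_mul_triple_of_eq_zero (P := P) (if_neg hjk)]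
      exact (PrincipalFactor.of_mul_of_not_mem (c.mul_not_mem i g j k h l hjk)).symm
  have hbij : Function.Bijective f := by
    constructor
    · rintro (_ | ⟨i, g, j⟩) (_ | ⟨k, h, l⟩) hxy
      · rfl
      · cases hxy
      · cases hxy
      · have : c.toFun i g j = c.toFun k h l :=
          congrArg Subtype.val (PrincipalFactor.of.inj hxy)
        obtain ⟨rfl, rfl, rfl⟩ := c.inj this
        rfl
    · rintro (_ | ⟨s, hs⟩)
      · exact ⟨.zero, rfl⟩
      · obtain ⟨i, g, j, rfl⟩ := c.surj s hs
        exact ⟨.triple i g j, rfl⟩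
  exact ⟨P, ⟨(MulEquiv.ofBijective (MulHom.mk f hf) hbij).symm⟩⟩

/-- If a `𝒥`-class of an inverse semigroup has a principal factor that is isomorphic to a Rees
`0`-matrix semigroup, then the matrix is monomial, and there are Brandt coordinates over the same
index set and the same group. -/
theorem nonempty_brandtCoordinates_of_mulEquiv (hS : IsInverseSemigroup S) (hJ : IsJClass J)
    {P : Matrix K K (WithZero G)} (φ : PrincipalFactor J ≃* ReesZeroMatrix P) :
    Nonempty (BrandtCoordinates J K G) := by
  have hφ0 : φ .zero = .zero := by
    have h := φ.map_mul .zero (φ.symm .zero)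
    rwa [PrincipalFactor.zero_mul, φ.apply_symm_apply, ReesZeroMatrix.mul_zero] at h
  have hex : ∀ κ g l, ∃ s : J, φ (.of s) = .triple κ g l := by
    intro κ g l
    obtain ⟨x, hx⟩ := φ.surjective (.triple κ g l)
    rcases x with _ | s
    · rw [hφ0] at hx
      cases hx
    · exact ⟨s, hx⟩
  choose s hs using hex
  have hinj : ∀ {i g j k h l}, (s i g j : S) = s k h l → i = k ∧ g = h ∧ j = l := by
    intro i g j k h l he
    have := hs i g j
    rw [Subtype.ext he, hs k h l] at this
    cases this
    exact ⟨rfl, rfl, rfl⟩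
  have hsurj : ∀ x (hx : x ∈ J), ∃ i g j, (s i g j : S) = x := by
    intro x hx
    rcases hy : φ (.of ⟨x, hx⟩) with _ | ⟨i, g, j⟩
    · rw [← hφ0] at hy
      cases φ.injective hy
    · refine ⟨i, g, j, ?_⟩
      have := PrincipalFactor.of.inj (φ.injective ((hs i g j).trans hy.symm))
      rw [this]
  have hmul : ∀ {κ g l μ h ν p}, P l μ = ((p : G) : WithZero G) →
      (s κ g l : S) * s μ h ν = s κ (g * p * h) ν := by
    intro κ g l μ h ν p hp
    have h1 : φ (.of (s κ g l) * .of (s μ h ν)) = φ (.of (s κ (g * p * h) ν)) := by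
      rw [φ.map_mul, hs, hs, hs, ReesZeroMatrix.triple_mul_triple hp]
    have h2 := φ.injective h1
    by_cases hm : (s κ g l : S) * s μ h ν ∈ J
    · rw [PrincipalFactor.of_mul_of_mem hm] at h2
      exact congrArg Subtype.val (PrincipalFactor.of.inj h2)
    · rw [PrincipalFactor.of_mul_of_not_mem hm] at h2
      cases h2
  have hmul0 : ∀ {κ g l μ h ν}, P l μ = 0 → (s κ g l : S) * s μ h ν ∉ J := by
    intro κ g l μ h ν hp hm
    have h1 : φ (.of (s κ g l) * .of (s μ h ν)) = φ .zero := by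
      rw [φ.map_mul, hs, hs, hφ0, ReesZeroMatrix.triple_mul_triple_of_eq_zero hp]
    have h2 := φ.injective h1
    rw [PrincipalFactor.of_mul_of_mem hm] at h2
    cases h2
  have hidem : ∀ {l μ p}, P l μ = ((p : G) : WithZero G) →
      (s μ p⁻¹ l : S) * s μ p⁻¹ l = s μ p⁻¹ l := by
    intro l μ p hp
    rw [hmul hp, inv_mul_cancel, one_mul]
  have hcoe : ∀ {l μ}, P l μ ≠ 0 → ∃ p : G, P l μ = p := fun h => by
    obtain ⟨p, hp⟩ := WithZero.ne_zero_iff_exists.1 h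
    exact ⟨p, hp.symm⟩
  -- Two nonzero entries in a row give two idempotents whose products in either order have first
  -- coordinates `μ` and `μ'`; idempotents commute.
  have hrow : ∀ {l μ μ'}, P l μ ≠ 0 → P l μ' ≠ 0 → μ = μ' := by
    intro l μ μ' h h'
    obtain ⟨p, hp⟩ := hcoe h
    obtain ⟨q, hq⟩ := hcoe h'
    have := hS.idem_comm (hidem hp) (hidem hq)
    rw [hmul hq, hmul hp] at this
    exact (hinj this).1
  have hcol : ∀ {l l' μ}, P l μ ≠ 0 → P l' μ ≠ 0 → l = l' := by
    intro l l' μ h h'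
    obtain ⟨p, hp⟩ := hcoe h
    obtain ⟨q, hq⟩ := hcoe h'
    have := hS.idem_comm (hidem hp) (hidem hq)
    rw [hmul hp, hmul hq] at this
    exact (hinj this).2.2.symm
  -- For `x = (k, 1, k)`, both `x * x⁻¹` and `x⁻¹ * x` stay in `J`, so row `k` and column `k` each
  -- meet a nonzero entry.
  have hreg : ∀ k, (∃ μ, P k μ ≠ 0) ∧ ∃ l, P l k ≠ 0 := by
    intro k
    obtain ⟨x, hxe⟩ : ∃ x : S, s k 1 k = x := ⟨_, rfl⟩
    have hx : x ∈ J := hxe ▸ (s k 1 k).2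
    obtain ⟨i, g, j, hy⟩ := hsurj _ (hJ.inv_mem hS hx)
    have h1 : x * hS.inv x ∈ J := hJ.mem_of_greenJ hx (hS.greenJ_mul_inv x)
    have h2 : hS.inv x * x ∈ J := by
      have := hS.greenJ_mul_inv (hS.inv x)
      rw [hS.inv_inv] at this
      exact hJ.mem_of_greenJ (hJ.inv_mem hS hx) this
    rw [← hy, ← hxe] at h1 h2
    exact ⟨⟨i, fun h => hmul0 h h1⟩, ⟨j, fun h => hmul0 h h2⟩⟩
  have hcol' : ∀ μ, ∃ l, ∃ p : G, P l μ = p := fun μ => by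
    obtain ⟨l, hl⟩ := (hreg μ).2
    exact ⟨l, hcoe hl⟩
  choose π q hq using hcol'
  have hne : ∀ μ, P (π μ) μ ≠ 0 := fun μ => by rw [hq]; exact WithZero.coe_ne_zero
  -- Permuting the right index by `π` and rescaling by `q` normalises the monomial matrix to the
  -- identity matrix.
  refine ⟨⟨fun i g j => s i (g * (q j)⁻¹) (π j), ?_, fun _ _ _ => (s _ _ _).2, ?_, ?_, ?_⟩⟩
  · intro i g j k h l he
    obtain ⟨rfl, h2, h3⟩ := hinj he
    have hjl : j = l := hrow (hne j) (h3 ▸ hne l)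
    subst hjl
    exact ⟨rfl, mul_right_cancel h2, rfl⟩
  · intro x hx
    obtain ⟨i, g, l, rfl⟩ := hsurj x hx
    obtain ⟨μ, hμ⟩ := (hreg l).1
    have := hcol hμ (hne μ)
    subst this
    exact ⟨i, g * q μ, μ, by rw [mul_inv_cancel_right]⟩
  · intro i g j h l
    rw [hmul (hq j), inv_mul_cancel_right, mul_assoc]
  · intro i g j k h l hjk
    refine hmul0 (by_contra fun hP => hjk (hrow (hne j) hP))

end Rees

/-! ### Every `𝒥`-class of a finite inverse semigroup is a connected groupoid -/

section Intrinsic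

variable {S : Type u} [Semigroup S]

/-- An idempotent below an idempotent of the same `𝒥`-class of a finite inverse semigroup is
equal to it. -/
theorem IsInverseSemigroup.eq_of_idem_le [Finite S] (hS : IsInverseSemigroup S) {f g : S}
    (hf : f * f = f) (hg : g * g = g) (hfg : f * g = g) (hgf : g * f = g)
    (h : f ∈ principalIdeal g) : f = g := by
  obtain ⟨a, b, hab⟩ := hS.exists_of_mem_principalIdeal h
  have hcd : f * a * g * (g * b * f) = f := by
    calc f * a * g * (g * b * f) = f * (a * (g * g) * b) * f := by simp only [mul_assoc]
      _ = f := by rw [hg, ← hab, hf, hf]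
  have hcf : f * a * g * f = f * a * g := by rw [mul_assoc, hgf]
  have hfc : f * (f * a * g) = f * a * g := by simp only [← mul_assoc, hf]
  have hfd : f * (g * b * f) = g * b * f := by simp only [← mul_assoc, hfg]
  have hgd : g * (g * b * f) = g * b * f := by simp only [← mul_assoc, hg]
  set c := f * a * g
  set d := g * b * f
  -- Since `c * d = f`, left multiplication by `c` is surjective on this finite set, hence
  -- injective, and so `d * c = f` as well. As `g * d = d`, this puts `f` below `g`.
  let T : {x // f * x = x} → {x // f * x = x} := fun x => ⟨c * x, by rw [← mul_assoc, hfc]⟩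
  have hT : Function.Surjective T := fun x =>
    ⟨⟨d * x, by rw [← mul_assoc, hfd]⟩, Subtype.ext (by
      change c * (d * x) = x
      rw [← mul_assoc, hcd, x.2])⟩
  have hdc : d * c = f := by
    have : T ⟨d * c, by rw [← mul_assoc, hfd]⟩ = T ⟨f, hf⟩ := Subtype.ext (by
      change c * (d * c) = c * f
      rw [← mul_assoc, hcd, hfc, hcf])
    exact congrArg Subtype.val (Finite.injective_iff_surjective.2 hT this)
  calc f = g * (d * c) := by rw [← mul_assoc, hgd, hdc]
    _ = g := by rw [hdc, hgf]

/-- Writing `e = p * f * q`, the element `a = e * p * f` satisfies `a * a⁻¹ = e`. Then `a⁻¹ * a`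
lies below `f` in the same `𝒥`-class, and finiteness forces equality. -/
theorem IsInverseSemigroup.exists_connecting [Finite S] (hS : IsInverseSemigroup S) {e f : S}
    (he : e * e = e) (hf : f * f = f) (hef : GreenJ e f) :
    ∃ a, a * hS.inv a = e ∧ hS.inv a * a = f := by
  obtain ⟨h1, h2⟩ := greenJ_iff.1 hef
  obtain ⟨p, q, hpq⟩ := hS.exists_of_mem_principalIdeal h1
  have hab : e * p * f * (f * q * e) = e := by
    calc e * p * f * (f * q * e) = e * (p * (f * f) * q) * e := by simp only [mul_assoc]
      _ = e := by rw [hf, ← hpq, he, he]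
  have hea : e * (e * p * f) = e * p * f := by simp only [← mul_assoc, he]
  have haf : e * p * f * f = e * p * f := by rw [mul_assoc, hf]
  set a := e * p * f
  have h3 : a * hS.inv a = e := by
    calc a * hS.inv a = e * (a * hS.inv a) := by rw [← mul_assoc, hea]
      _ = a * hS.inv a * e := hS.idem_comm he (hS.mul_inv_idem a)
      _ = a * hS.inv a * (a * (f * q * e)) := by rw [hab]
      _ = e := by rw [← mul_assoc, hS.mul_inv_mul, hab]
  have h4 : hS.inv a * a * f = hS.inv a * a := by rw [mul_assoc, haf]
  refine ⟨a, h3, (hS.eq_of_idem_le hf (hS.inv_mul_idem a) ?_ h4 ?_).symm⟩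
  · rw [← hS.idem_comm (hS.inv_mul_idem a) hf, h4]
  · refine principalIdeal_subset ?_ h2
    have := mul_mul_mem_principalIdeal a (hS.inv a * a) (hS.inv a)
    rwa [← mul_assoc a, hS.mul_inv_mul, h3] at this

/-- The maximal subgroup at the idempotent `e`. -/
def MaximalSubgroup (hS : IsInverseSemigroup S) (e : S) : Type u :=
  {g : S // g * hS.inv g = e ∧ hS.inv g * g = e}

variable {hS : IsInverseSemigroup S} {e : S}

theorem MaximalSubgroup.id_mul (g : MaximalSubgroup hS e) : e * g.1 = g.1 := by
  have := hS.mul_inv_mul g.1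
  rwa [g.2.1] at this

theorem MaximalSubgroup.mul_id (g : MaximalSubgroup hS e) : g.1 * e = g.1 := by
  have := hS.mul_inv_mul g.1
  rwa [mul_assoc, g.2.2] at this

/-- The group structure of the maximal subgroup at an idempotent. -/
noncomputable abbrev MaximalSubgroup.group (he : e * e = e) : Group (MaximalSubgroup hS e) :=
  letI : Mul (MaximalSubgroup hS e) := ⟨fun g h => ⟨g.1 * h.1, by
    rw [hS.inv_mul_rev]
    constructor
    · calc g.1 * h.1 * (hS.inv h.1 * hS.inv g.1) = g.1 * (h.1 * hS.inv h.1) * hS.inv g.1 := by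
            simp only [mul_assoc]
        _ = e := by rw [h.2.1, g.mul_id, g.2.1]
    · calc hS.inv h.1 * hS.inv g.1 * (g.1 * h.1)
          = hS.inv h.1 * ((hS.inv g.1 * g.1) * h.1) := by simp only [mul_assoc]
        _ = e := by rw [g.2.2, h.id_mul, h.2.2]⟩⟩
  letI : One (MaximalSubgroup hS e) := ⟨⟨e, by rw [hS.inv_of_idem he, he, and_self]⟩⟩
  letI : Inv (MaximalSubgroup hS e) := ⟨fun g => ⟨hS.inv g.1, by
    rw [hS.inv_inv]
    exact g.2.symm⟩⟩
  Group.ofLeftAxioms (fun a b c => Subtype.ext (mul_assoc a.1 b.1 c.1))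
    (fun a => Subtype.ext a.id_mul) fun a => Subtype.ext a.2.2

/-- A `𝒥`-class of a finite inverse semigroup has Brandt coordinates. -/
theorem IsJClass.exists_brandtCoordinates [Finite S] (hS : IsInverseSemigroup S) {J : Set S}
    (hJ : IsJClass J) :
    ∃ (K G : Type u) (_ : Group G), Nonempty (BrandtCoordinates J K G) := by
  obtain ⟨x₀, hx₀⟩ := hJ.nonempty
  have hmemr : ∀ x ∈ J, x * hS.inv x ∈ J := fun x hx =>
    hJ.mem_of_greenJ hx (hS.greenJ_mul_inv x)
  have hmeml : ∀ x ∈ J, hS.inv x * x ∈ J := fun x hx => by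
    have := hmemr _ (hJ.inv_mem hS hx)
    rwa [hS.inv_inv] at this
  obtain ⟨e, heJ, he⟩ : ∃ e ∈ J, e * e = e := ⟨_, hmemr _ hx₀, hS.mul_inv_idem x₀⟩
  let K := {f : S // f ∈ J ∧ f * f = f}
  let _ := MaximalSubgroup.group (hS := hS) he
  have hconn : ∀ f : K, ∃ a, a * hS.inv a = e ∧ hS.inv a * a = f.1 := fun f =>
    hS.exists_connecting he f.2.2 (hJ.greenJ heJ f.2.1)
  choose a ha ha' using hconn
  have hea : ∀ f, e * a f = a f := fun f => by rw [← ha f, hS.mul_inv_mul]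
  have hae : ∀ f, hS.inv (a f) * e = hS.inv (a f) := fun f => by
    rw [← ha f, ← mul_assoc, hS.inv_mul_inv]
  have haf : ∀ f, a f * f.1 = a f := fun f => by rw [← ha' f, ← mul_assoc, hS.mul_inv_mul]
  have hfa : ∀ f : K, f.1 * hS.inv (a f) = hS.inv (a f) := fun f => by
    rw [← ha' f, hS.inv_mul_inv]
  -- The objects are the idempotents of `J`; the chosen arrows `a f` from `e` to `f` transport every
  -- arrow to a loop at `e`.
  let t : K → MaximalSubgroup hS e → K → S := fun f g k => hS.inv (a f) * g.1 * a k
  have hback : ∀ f g k, a f * t f g k * hS.inv (a k) = g.1 := fun f g k => by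
    calc a f * t f g k * hS.inv (a k)
        = (a f * hS.inv (a f)) * g.1 * (a k * hS.inv (a k)) := by simp only [t, mul_assoc]
      _ = g.1 := by rw [ha, ha, g.id_mul, g.mul_id]
  have hinv : ∀ f g k, hS.inv (t f g k) = hS.inv (a k) * hS.inv g.1 * a f := fun f g k => by
    simp only [t, hS.inv_mul_rev, hS.inv_inv, mul_assoc]
  have hleft : ∀ f g k, t f g k * hS.inv (t f g k) = f.1 := fun f g k => by
    calc t f g k * hS.inv (t f g k)
        = hS.inv (a f) * (g.1 * (a k * hS.inv (a k)) * hS.inv g.1) * a f := by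
          rw [hinv]; simp only [t, mul_assoc]
      _ = f.1 := by rw [ha, g.mul_id, g.2.1, mul_assoc, hea, ha']
  have hright : ∀ f g k, hS.inv (t f g k) * t f g k = k.1 := fun f g k => by
    calc hS.inv (t f g k) * t f g k
        = hS.inv (a k) * (hS.inv g.1 * ((a f * hS.inv (a f)) * g.1)) * a k := by
          rw [hinv]; simp only [t, mul_assoc]
      _ = k.1 := by rw [ha, g.id_mul, g.2.2, mul_assoc, hea, ha']
  refine ⟨K, MaximalSubgroup hS e, inferInstance, ⟨⟨t, ?_, ?_, ?_, ?_, ?_⟩⟩⟩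
  · intro f g k f' g' k' h
    have hf : f = f' := Subtype.ext (by rw [← hleft f g k, h, hleft])
    have hk : k = k' := Subtype.ext (by rw [← hright f g k, h, hright])
    subst hf hk
    exact ⟨rfl, Subtype.ext (by rw [← hback f g k, h, hback]), rfl⟩
  · intro f g k
    have h := hS.greenJ_mul_inv (t f g k)
    rw [hleft] at h
    exact hJ.mem_of_greenJ f.2.1 (Eq.symm h)
  · intro x hx
    let f : K := ⟨_, hmemr x hx, hS.mul_inv_idem x⟩
    let k : K := ⟨_, hmeml x hx, hS.inv_mul_idem x⟩
    have hf : hS.inv (a f) * a f = x * hS.inv x := ha' f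
    have hk : hS.inv (a k) * a k = hS.inv x * x := ha' k
    refine ⟨f, ⟨a f * x * hS.inv (a k), ?_, ?_⟩, k, ?_⟩
    · calc a f * x * hS.inv (a k) * hS.inv (a f * x * hS.inv (a k))
          = a f * (x * (hS.inv (a k) * a k) * hS.inv x) * hS.inv (a f) := by
            simp only [hS.inv_mul_rev, hS.inv_inv, mul_assoc]
        _ = a f * (hS.inv (a f) * a f) * hS.inv (a f) := by
            rw [hk, ← mul_assoc x, hS.mul_inv_mul, hf]
        _ = e := by rw [← mul_assoc, hS.mul_inv_mul, ha]
    · calc hS.inv (a f * x * hS.inv (a k)) * (a f * x * hS.inv (a k))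
          = a k * (hS.inv x * (hS.inv (a f) * a f) * x) * hS.inv (a k) := by
            simp only [hS.inv_mul_rev, hS.inv_inv, mul_assoc]
        _ = a k * (hS.inv (a k) * a k) * hS.inv (a k) := by
            rw [hf, ← mul_assoc (hS.inv x), hS.inv_mul_inv, hk]
        _ = e := by rw [← mul_assoc, hS.mul_inv_mul, ha]
    · calc hS.inv (a f) * (a f * x * hS.inv (a k)) * a k
          = (hS.inv (a f) * a f) * x * (hS.inv (a k) * a k) := by simp only [mul_assoc]
        _ = x := by rw [hf, hk, hS.mul_inv_mul, ← mul_assoc, hS.mul_inv_mul]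
  · intro f g k h l
    calc t f g k * t k h l
        = hS.inv (a f) * (g.1 * (a k * hS.inv (a k))) * h.1 * a l := by simp only [t, mul_assoc]
      _ = hS.inv (a f) * (g.1 * h.1) * a l := by rw [ha, g.mul_id]; simp only [mul_assoc]
  -- The product factors through the idempotent `j * k`. If it were in `J`, then `j * k`, which is
  -- below both `j` and `k`, would equal each of them.
  · intro f g j k h l hjk hmem
    have h1 : t f g j * t k h l = hS.inv (a f) * g.1 * a j * (j.1 * k.1) *
        (hS.inv (a k) * h.1 * a l) := by
      calc t f g j * t k h l
          = hS.inv (a f) * g.1 * (a j * j.1) * ((k.1 * hS.inv (a k)) * h.1 * a l) := by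
            rw [haf, hfa]
        _ = _ := by simp only [mul_assoc]
    have h2 : t f g j * t k h l ∈ principalIdeal (j.1 * k.1) :=
      h1 ▸ mul_mul_mem_principalIdeal _ _ _
    have hc := hS.idem_comm j.2.2 k.2.2
    have hi := hS.idem_mul j.2.2 k.2.2
    have key : ∀ i ∈ J, i ∈ principalIdeal (j.1 * k.1) := fun i hi =>
      principalIdeal_subset h2 (greenJ_iff.1 (hJ.greenJ hi hmem)).1
    have hj : j.1 = j.1 * k.1 := hS.eq_of_idem_le j.2.2 hi (by rw [← mul_assoc, j.2.2])
      (by rw [hc, mul_assoc, j.2.2]) (key _ j.2.1)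
    have hk : k.1 = j.1 * k.1 := hS.eq_of_idem_le k.2.2 hi (by rw [hc, ← mul_assoc, k.2.2])
      (by rw [mul_assoc, k.2.2]) (key _ k.2.1)
    exact hjk (Subtype.ext (hj.trans hk.symm))

end Intrinsic

end SemigroupCovering

theorem theorem2 (I : Type u) [Semigroup I] [Finite I] (hI : IsInverseSemigroup I) :
    (IsGroupSemigroup I → sigmaI I = sigmaG I) ∧
    ((¬ ∃ J : Set I, IsJClass J ∧ Subsemigroup.closure J = ⊤) → sigmaI I = 2) ∧
    (¬ IsGroupSemigroup I → ∀ J : Set I, IsJClass J → Subsemigroup.closure J = ⊤ →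
      (∃ (K G : Type u) (_ : Group G) (P : Matrix K K (WithZero G)),
        2 ≤ Nat.card K ∧ Nonempty (PrincipalFactor J ≃* ReesZeroMatrix P)) ∧
      ∀ (K : Type v) (G : Type w) [Group G] (P : Matrix K K (WithZero G)),
        Nonempty (PrincipalFactor J ≃* ReesZeroMatrix P) →
          2 ≤ Nat.card K ∧
          (Nat.card K = 2 → Nat.card G = 1 → sigmaI I = ⊤) ∧
          (Nat.card K = 2 → 1 < Nat.card G →
            ∃ n : ℕ, IsMinProperIndex G n ∧ sigmaI I = (n : ℕ∞) + 1) ∧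
          (2 < Nat.card K → sigmaI I = 3)) := by
  refine ⟨fun h => h.sigmaI_eq_sigmaG, sigmaI_eq_two hI, fun hgr J hJ hgen => ⟨?_, ?_⟩⟩
  · obtain ⟨K, G, hG, ⟨c⟩⟩ := hJ.exists_brandtCoordinates hI
    obtain ⟨P, hP⟩ := c.nonempty_mulEquiv
    exact ⟨K, G, hG, P, c.two_le_card hJ.nonempty hgen hgr, hP⟩
  · rintro K G _ P ⟨φ⟩
    obtain ⟨c⟩ := nonempty_brandtCoordinates_of_mulEquiv hI hJ φ
    have hmax := hJ.isMaximalJClass hgen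
    exact ⟨c.two_le_card hJ.nonempty hgen hgr, c.sigmaI_eq_top hI hgen,
      c.sigmaI_eq_succ hI hmax hgen, c.sigmaI_eq_three hI hmax hgen⟩
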